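/- Let $\tau$ be the Ramanujan tau function, i.e. the integers $\tau(k)$, $k\ge 1$, defined by the generating function $$\sum_{k=1}^{\infty}\tau(k)x^k = x\prod_{k=1}^{\infty}\left(1-x^k\right)^{24},\qquad |x|<1 .$$ Then for every prime $p$ and all integers $m,n\ge 1$, $$\tau\left(p^{m+n}\right)=\tau\left(p^m\right)\tau\left(p^n\right)-p^{11}\,\tau\left(p^{m-1}\right)\tau\left(p^{n-1}\right).$$ -/

import Mathlib

section RamanujanTau

open scoped PowerSeries PowerSeries.WithPiTopology

/-- The infinite product `∏_{k ≥ 1} (1 - X ^ k) ^ 24` converges in `ℤ⟦X⟧` for the topology of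
coefficientwise stabilization (the product topology with `ℤ` discrete). -/
theorem ramanujanTau_multipliable :
    Multipliable fun k : ℕ ↦ (1 - (PowerSeries.X : ℤ⟦X⟧) ^ (k + 1)) ^ 24 :=
  (PowerSeries.WithPiTopology.multipliable_one_sub_X_pow ℤ).pow 24

/-- The Ramanujan `τ` function: `τ(n)` is the coefficient of `X ^ n` in
`X * ∏_{k ≥ 1} (1 - X ^ k) ^ 24`. The product is indexed by `k ≥ 0` with exponent `k + 1`. -/
noncomputable def ramanujanTau (n : ℕ) : ℤ :=
  PowerSeries.coeff n
    ((PowerSeries.X : ℤ⟦X⟧) * ∏' k : ℕ, (1 - (PowerSeries.X : ℤ⟦X⟧) ^ (k + 1)) ^ 24)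

end RamanujanTau

/-! ### Identification of `ramanujanTau` with the `q`-expansion of the discriminant. -/

section Coefficients

open Filter Topology UpperHalfPlane Polynomial
open scoped PowerSeries PowerSeries.WithPiTopology

/-! The numbers `τ(n)` are the `q`-coefficients of `Δ` (`coeff_qExpansion_discriminant`). The Hecke
operator `T_p` preserves level-one cusp forms of each weight, and those of weight 12 are the
multiples of `Δ`, so `T_p Δ = c Δ`. Comparing coefficients, with `τ(1) = 1`, gives `c = τ(p)` and
`ramanujanTau_hecke`. At `n = p ^ (r + 1)` this is a two-term recurrence along powers of `p`, from
which the identity follows by induction. -/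

/-- The derivatives at `0` of a polynomial function are given by its coefficients. -/
theorem Polynomial.iterate_deriv_eval {R : Type*} [NontriviallyNormedField R] (P : R[X]) (n : ℕ) :
    deriv^[n] (fun x ↦ P.eval x) = fun x ↦ (Polynomial.derivative^[n] P).eval x := by
  induction n generalizing P with
  | zero => rfl
  | succ n ih =>
    rw [Function.iterate_succ_apply, Function.iterate_succ_apply, ← ih]
    congr 1
    ext x
    exact P.deriv

/-- If polynomial functions converge locally uniformly near `0`, their coefficients converge to the
Taylor coefficients of the limit. -/
theorem TendstoLocallyUniformlyOn.tendsto_polynomial_coeff {ι : Type*} {l : Filter ι} [l.NeBot]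
    {P : ι → ℂ[X]} {F : ℂ → ℂ} {U : Set ℂ} (hU : IsOpen U) (h0 : (0 : ℂ) ∈ U)
    (h : TendstoLocallyUniformlyOn (fun i x ↦ (P i).eval x) F l U) (n : ℕ) :
    Tendsto (fun i ↦ (P i).coeff n) l (𝓝 ((n.factorial : ℂ)⁻¹ * iteratedDeriv n F 0)) := by
  -- Weierstrass: locally uniform limits of holomorphic functions commute with differentiation.
  have key : TendstoLocallyUniformlyOn
      (fun i x ↦ (Polynomial.derivative^[n] (P i)).eval x) (_root_.deriv^[n] F) l U := by
    induction n with
    | zero => exact h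
    | succ n ih =>
      have := ih.deriv
        (Eventually.of_forall fun i ↦ (Polynomial.differentiable _).differentiableOn) hU
      rw [Function.iterate_succ_apply']
      refine this.congr fun i x hx ↦ ?_
      simp [Function.iterate_succ_apply']
  have := (key.tendsto_at h0).const_mul (n.factorial : ℂ)⁻¹
  rw [iteratedDeriv_eq_iterate]
  refine this.congr fun i ↦ ?_
  rw [← Polynomial.coeff_zero_eq_eval_zero, Polynomial.coeff_iterate_derivative]
  simp [Nat.descFactorial_self, Nat.factorial_ne_zero]

/-- The partial products of `X * ∏ (1 - X ^ (k + 1)) ^ 24`, as polynomials. -/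
noncomputable def deltaPartialProd (R : Type*) [CommRing R] (s : Finset ℕ) : R[X] :=
  X * ∏ k ∈ s, (1 - X ^ (k + 1)) ^ 24

theorem coeff_deltaPartialProd (s : Finset ℕ) (n : ℕ) :
    (deltaPartialProd ℂ s).coeff n = ((PowerSeries.coeff n
      (PowerSeries.X * ∏ k ∈ s, (1 - (PowerSeries.X : ℤ⟦X⟧) ^ (k + 1)) ^ 24) : ℤ) : ℂ) := by
  have h : (deltaPartialProd ℤ s : ℤ⟦X⟧) =
      PowerSeries.X * ∏ k ∈ s, (1 - (PowerSeries.X : ℤ⟦X⟧) ^ (k + 1)) ^ 24 := by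
    rw [deltaPartialProd, ← Polynomial.coeToPowerSeries.ringHom_apply]
    simp only [map_mul, map_prod, map_pow, map_sub, map_one]
    simp
  have h' : deltaPartialProd ℂ s = (deltaPartialProd ℤ s).map (Int.castRingHom ℂ) := by
    simp [deltaPartialProd, Polynomial.map_prod]
  rw [← h, h', Polynomial.coeff_map, Polynomial.coeff_coe]
  rfl

theorem eventually_coeff_deltaPartialProd (n : ℕ) :
    ∀ᶠ s in atTop, (deltaPartialProd ℂ s).coeff n = ramanujanTau n := by
  have h : Tendsto (fun s : Finset ℕ ↦
      PowerSeries.X * ∏ k ∈ s, (1 - (PowerSeries.X : ℤ⟦X⟧) ^ (k + 1)) ^ 24) atTop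
      (𝓝 (PowerSeries.X * ∏' k : ℕ, (1 - (PowerSeries.X : ℤ⟦X⟧) ^ (k + 1)) ^ 24)) :=
    (show Tendsto _ _ _ from ramanujanTau_multipliable.hasProd).const_mul _
  have h2 := ((PowerSeries.WithPiTopology.continuous_coeff ℤ n).tendsto _).comp h
  rw [nhds_discrete, tendsto_pure] at h2
  filter_upwards [h2] with s hs
  rw [coeff_deltaPartialProd]
  exact congrArg _ hs

theorem tendstoLocallyUniformlyOn_deltaPartialProd :
    TendstoLocallyUniformlyOn (fun s q ↦ (deltaPartialProd ℂ s).eval q)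
      (fun q ↦ q * ∏' i, (1 - q ^ (i + 1)) ^ 24) atTop (Metric.ball (0 : ℂ) 1) := by
  have h : TendstoLocallyUniformlyOn (fun (s : Finset ℕ) (q : ℂ) ↦ ∏ k ∈ s, (1 - q ^ (k + 1)))
      (fun q ↦ ∏' i, (1 - q ^ (i + 1))) atTop (Metric.ball (0 : ℂ) 1) :=
    ModularForm.multipliableLocallyUniformlyOn_one_sub_pow.hasProdLocallyUniformlyOn
  have hc : ContinuousOn (fun q : ℂ ↦ ∏' i, (1 - q ^ (i + 1))) (Metric.ball (0 : ℂ) 1) :=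
    ModularForm.differentiableOn_tprod_one_sub_pow.continuousOn
  have hpow (m : ℕ) : TendstoLocallyUniformlyOn
      (fun (s : Finset ℕ) (q : ℂ) ↦ (∏ k ∈ s, (1 - q ^ (k + 1))) ^ m)
      (fun q ↦ (∏' i, (1 - q ^ (i + 1))) ^ m) atTop (Metric.ball (0 : ℂ) 1) := by
    induction m with
    | zero =>
      simp only [pow_zero]
      exact (tendsto_const_nhds.tendstoUniformlyOn_const _).tendstoLocallyUniformlyOn
    | succ m ih =>
      simp only [pow_succ]
      exact ih.fun_mul₀ h (hc.pow m) hc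
  have hid : TendstoLocallyUniformlyOn (fun (_ : Finset ℕ) (q : ℂ) ↦ q) (fun q ↦ q) atTop
      (Metric.ball (0 : ℂ) 1) := fun u hu x _ ↦
    ⟨Set.univ, univ_mem, Eventually.of_forall fun _ y _ ↦ refl_mem_uniformity hu⟩
  refine ((hid.fun_mul₀ (hpow 24) continuousOn_id (hc.pow 24)).congr fun s q _ ↦ ?_).congr_right
    fun q hq ↦ ?_
  · simp [deltaPartialProd, Polynomial.eval_prod, Finset.prod_pow]
  · dsimp only
    rw [(ModularForm.multipliable_one_sub_pow (by simpa using hq)).tprod_pow]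

-- The same coefficients have two limits: formally they stabilize at `τ(n)`, analytically they tend
-- to the Taylor coefficients of the cusp function of `Δ`.
open ModularForm in
theorem coeff_qExpansion_discriminant (n : ℕ) :
    (qExpansion 1 discriminant).coeff n = ramanujanTau n := by
  have h := tendstoLocallyUniformlyOn_deltaPartialProd.tendsto_polynomial_coeff
    Metric.isOpen_ball (Metric.mem_ball_self one_pos) n
  have h2 : Tendsto (fun s ↦ (deltaPartialProd ℂ s).coeff n) atTop (𝓝 (ramanujanTau n : ℂ)) :=
    tendsto_const_nhds.congr' ((eventually_coeff_deltaPartialProd n).mono fun s hs ↦ hs.symm)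
  rw [tendsto_nhds_unique h2 h, qExpansion_coeff]
  congr 1
  exact Filter.EventuallyEq.iteratedDeriv_eq n
    (discriminant_cuspFunction_eqOn.eventuallyEq_of_mem (Metric.ball_mem_nhds 0 one_pos))

end Coefficients

/-! ### Hecke operators in level one and their coset representatives. -/

section Hecke

open UpperHalfPlane ModularForm Matrix MatrixGroups Filter OnePoint
open scoped Manifold

/-- The matrix `!![1, b; 0, p]`. -/
noncomputable def heckeUpper (p : ℕ) [NeZero p] (b : ℤ) : GL (Fin 2) ℝ :=
  Matrix.GeneralLinearGroup.mkOfDetNeZero !![1, (b : ℝ); 0, (p : ℝ)] (by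
    simp [NeZero.ne p])

/-- The matrix `!![p, 0; 0, 1]`. -/
noncomputable def heckeDiag (p : ℕ) [NeZero p] : GL (Fin 2) ℝ :=
  Matrix.GeneralLinearGroup.mkOfDetNeZero !![(p : ℝ), 0; 0, 1] (by
    simp [NeZero.ne p])

theorem coe_heckeUpper (p : ℕ) [NeZero p] (b : ℤ) :
    (heckeUpper p b : Matrix (Fin 2) (Fin 2) ℝ) = !![1, (b : ℝ); 0, (p : ℝ)] := rfl

theorem coe_heckeDiag (p : ℕ) [NeZero p] :
    (heckeDiag p : Matrix (Fin 2) (Fin 2) ℝ) = !![(p : ℝ), 0; 0, 1] := rfl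

section Cosets

variable {p : ℕ} [NeZero p]

theorem coe_mapGL_apply (γ : SL(2, ℤ)) (i j : Fin 2) :
    ((γ : GL (Fin 2) ℝ) : Matrix (Fin 2) (Fin 2) ℝ) i j = (γ i j : ℝ) := rfl

theorem heckeUpper_eq_T_zpow_mul {a b : ℤ} (m : ℤ) (h : a = b + m * p) :
    heckeUpper p a = ((ModularGroup.T ^ m : SL(2, ℤ)) : GL (Fin 2) ℝ) * heckeUpper p b := by
  ext i j
  rw [Units.val_mul, Matrix.mul_apply, Fin.sum_univ_two, coe_mapGL_apply, coe_mapGL_apply,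
    ModularGroup.coe_T_zpow, coe_heckeUpper, coe_heckeUpper]
  fin_cases i <;> fin_cases j <;> simp [h]

theorem heckeUpper_mul_T (a : ℤ) :
    heckeUpper p a * (ModularGroup.T : SL(2, ℤ)) = heckeUpper p (a + 1) := by
  ext i j
  rw [Units.val_mul, Matrix.mul_apply, Fin.sum_univ_two, coe_mapGL_apply, coe_mapGL_apply,
    ModularGroup.coe_T, coe_heckeUpper, coe_heckeUpper]
  fin_cases i <;> fin_cases j <;> simp [add_comm]

theorem heckeDiag_mul_T :
    heckeDiag p * (ModularGroup.T : SL(2, ℤ)) =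
      ((ModularGroup.T ^ (p : ℤ) : SL(2, ℤ)) : GL (Fin 2) ℝ) * heckeDiag p := by
  ext i j
  rw [Units.val_mul, Units.val_mul, Matrix.mul_apply, Matrix.mul_apply, Fin.sum_univ_two,
    Fin.sum_univ_two]
  simp only [coe_mapGL_apply]
  rw [ModularGroup.coe_T_zpow, ModularGroup.coe_T, coe_heckeDiag]
  fin_cases i <;> fin_cases j <;> simp

theorem heckeDiag_mul_S :
    heckeDiag p * (ModularGroup.S : SL(2, ℤ)) =
      ((ModularGroup.S : SL(2, ℤ)) : GL (Fin 2) ℝ) * heckeUpper p 0 := by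
  ext i j
  rw [Units.val_mul, Units.val_mul, Matrix.mul_apply, Matrix.mul_apply, Fin.sum_univ_two,
    Fin.sum_univ_two]
  simp only [coe_mapGL_apply]
  rw [ModularGroup.coe_S, coe_heckeDiag, coe_heckeUpper]
  fin_cases i <;> fin_cases j <;> simp

theorem heckeUpper_zero_mul_S :
    heckeUpper p 0 * (ModularGroup.S : SL(2, ℤ)) =
      ((ModularGroup.S : SL(2, ℤ)) : GL (Fin 2) ℝ) * heckeDiag p := by
  ext i j
  rw [Units.val_mul, Units.val_mul, Matrix.mul_apply, Matrix.mul_apply, Fin.sum_univ_two,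
    Fin.sum_univ_two]
  simp only [coe_mapGL_apply]
  rw [ModularGroup.coe_S, coe_heckeDiag, coe_heckeUpper]
  fin_cases i <;> fin_cases j <;> simp

theorem exists_heckeUpper_mul_S {a b : ℤ} (h : (p : ℤ) ∣ a * b + 1) :
    ∃ γ : SL(2, ℤ), heckeUpper p a * (ModularGroup.S : SL(2, ℤ)) =
      (γ : GL (Fin 2) ℝ) * heckeUpper p b := by
  obtain ⟨c, hc⟩ := h
  have hc' : (a * b + 1 : ℝ) = p * c := by exact_mod_cast hc
  -- The matrix is `heckeUpper p a * S * (heckeUpper p b)⁻¹`; integrality and determinant 1 both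
  -- come from `a * b + 1 = p * c`.
  obtain ⟨γ, hγ⟩ : ∃ γ : SL(2, ℤ), (γ : Matrix (Fin 2) (Fin 2) ℤ) = !![a, -c; p, -b] :=
    ⟨⟨_, by simp [Matrix.det_fin_two]; linarith⟩, rfl⟩
  refine ⟨γ, ?_⟩
  ext i j
  rw [Units.val_mul, Units.val_mul, Matrix.mul_apply, Matrix.mul_apply, Fin.sum_univ_two,
    Fin.sum_univ_two]
  simp only [coe_mapGL_apply]
  rw [hγ, ModularGroup.coe_S, coe_heckeUpper, coe_heckeUpper]
  fin_cases i <;> fin_cases j <;> simp <;> linarith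

end Cosets

/-- The Hecke operator `T_p` on functions on the upper half plane. -/
noncomputable def heckeFun (p : ℕ) [NeZero p] (k : ℤ) (f : ℍ → ℂ) : ℍ → ℂ :=
  f ∣[k] heckeDiag p + ∑ j : ZMod p, f ∣[k] heckeUpper p j.val

/-! ### Modularity of `heckeFun`. -/

section Invariance

variable {p : ℕ} [hp : Fact p.Prime] {k : ℤ} {f : ℍ → ℂ}

theorem slash_congr_of_eq_mul (hf : ∀ γ : SL(2, ℤ), f ∣[k] γ = f) {A B : GL (Fin 2) ℝ}
    (γ : SL(2, ℤ)) (h : A = (γ : GL (Fin 2) ℝ) * B) : f ∣[k] A = f ∣[k] B := by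
  rw [h, SlashAction.slash_mul, ← SL_slash, hf]

theorem slash_heckeUpper_congr (hf : ∀ γ : SL(2, ℤ), f ∣[k] γ = f) {a b : ℤ}
    (h : (a : ZMod p) = b) : f ∣[k] heckeUpper p a = f ∣[k] heckeUpper p b := by
  obtain ⟨m, hm⟩ := (ZMod.intCast_eq_intCast_iff_dvd_sub b a p).mp h.symm
  exact slash_congr_of_eq_mul hf _ (heckeUpper_eq_T_zpow_mul m (by linarith))

theorem heckeFun_slash_T (hf : ∀ γ : SL(2, ℤ), f ∣[k] γ = f) :
    heckeFun p k f ∣[k] ModularGroup.T = heckeFun p k f := by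
  rw [heckeFun, SL_slash, SlashAction.add_slash, SlashAction.sum_slash]
  simp_rw [← SlashAction.slash_mul]
  rw [slash_congr_of_eq_mul hf _ heckeDiag_mul_T]
  congr 1
  refine Fintype.sum_equiv (Equiv.addRight 1) _ _ fun j ↦ ?_
  rw [heckeUpper_mul_T]
  exact slash_heckeUpper_congr hf (by simp)

/-- Up to left multiplication by `SL(2, ℤ)`, `S` swaps `heckeDiag p` with `heckeUpper p 0` and
permutes the remaining cosets by `j ↦ -j⁻¹`. -/
theorem heckeFun_slash_S (hf : ∀ γ : SL(2, ℤ), f ∣[k] γ = f) :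
    heckeFun p k f ∣[k] ModularGroup.S = heckeFun p k f := by
  rw [heckeFun, SL_slash, SlashAction.add_slash, SlashAction.sum_slash]
  simp_rw [← SlashAction.slash_mul]
  rw [slash_congr_of_eq_mul hf _ heckeDiag_mul_S,
    ← Finset.add_sum_erase _ _ (Finset.mem_univ (0 : ZMod p)),
    ← Finset.add_sum_erase _ (fun j : ZMod p ↦ f ∣[k] heckeUpper p j.val)
      (Finset.mem_univ (0 : ZMod p))]
  simp only [ZMod.val_zero, Nat.cast_zero]
  rw [slash_congr_of_eq_mul hf _ heckeUpper_zero_mul_S, add_left_comm]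
  congr 2
  refine Finset.sum_bij' (fun j _ ↦ -j⁻¹) (fun j _ ↦ -j⁻¹) (by simp) (by simp) (by simp [inv_neg])
    (by simp [inv_neg]) fun j hj ↦ ?_
  have hj : j ≠ 0 := by simpa using hj
  obtain ⟨γ, hγ⟩ := exists_heckeUpper_mul_S (p := p) (a := j.val) (b := (-j⁻¹).val) (by
    rw [← ZMod.intCast_zmod_eq_zero_iff_dvd]
    simp [hj])
  exact slash_congr_of_eq_mul hf γ hγ

end Invariance

/-- The Hecke operator `T_p` on cusp forms of level one. -/
noncomputable def CuspForm.hecke (p : ℕ) [Fact p.Prime] {k : ℤ} (f : CuspForm 𝒮ℒ k) :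
    CuspForm 𝒮ℒ k where
  toFun := heckeFun p k f
  slash_action_eq' := by
    rintro _ ⟨A, rfl⟩
    have hf : ∀ γ : SL(2, ℤ), ⇑f ∣[k] γ = ⇑f := fun γ ↦ f.slash_action_eq' _ ⟨γ, rfl⟩
    exact SlashInvariantForm.slash_action_generators_SL2Z
      (heckeFun_slash_S hf) (heckeFun_slash_T hf) A
  holo' := (f.holo'.slash k _).add (.sum fun j _ ↦ f.holo'.slash k _)
  zero_at_cusps' {c} hc := by
    have hf : ∀ γ : SL(2, ℤ), ⇑f ∣[k] γ = ⇑f := fun γ ↦ f.slash_action_eq' _ ⟨γ, rfl⟩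
    rw [Subgroup.IsArithmetic.isCusp_iff_isCusp_SL2Z] at hc
    rw [OnePoint.isZeroAt_iff_forall_SL2Z hc]
    -- Invariance reduces every cusp to `∞`.
    intro γ _
    rw [SlashInvariantForm.slash_action_generators_SL2Z
      (heckeFun_slash_S hf) (heckeFun_slash_T hf)]
    have h0 : IsZeroAtImInfty f := CuspFormClass.zero_at_infty f
    have h1 : IsZeroAtImInfty (⇑f ∣[k] heckeDiag p) := IsZeroAtImInfty.slash _
      (show (heckeDiag p : Matrix (Fin 2) (Fin 2) ℝ) 1 0 = 0 by simp [coe_heckeDiag]) h0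
    have h2 : Tendsto (fun z ↦ ∑ j : ZMod p, (⇑f ∣[k] heckeUpper p j.val) z) atImInfty
        (nhds (∑ j : ZMod p, 0)) :=
      tendsto_finsetSum _ fun j _ ↦ IsZeroAtImInfty.slash _
        (show (heckeUpper p j.val : Matrix (Fin 2) (Fin 2) ℝ) 1 0 = 0 by simp [coe_heckeUpper]) h0
    rw [Finset.sum_const_zero] at h2
    have h3 := Tendsto.add h1 h2
    rw [add_zero] at h3
    refine h3.congr fun z ↦ ?_
    simp [heckeFun]

/-! ### Action of `T_p` on `q`-expansions. -/

section QExpansion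

variable {p : ℕ} [NeZero p]

open Function.Periodic (qParam)

theorem det_heckeUpper (b : ℤ) : (heckeUpper p b).det.val = p := by
  simp [coe_heckeUpper, Matrix.det_fin_two]

theorem det_heckeDiag : (heckeDiag p).det.val = p := by
  simp [coe_heckeDiag, Matrix.det_fin_two]

theorem natCast_real_pos (p : ℕ) [NeZero p] : 0 < (p : ℝ) :=
  Nat.cast_pos.mpr (NeZero.pos p)

theorem denom_heckeUpper (b : ℤ) (z : ℂ) : denom (heckeUpper p b) z = p := by
  simp [denom, coe_heckeUpper]

theorem denom_heckeDiag (z : ℂ) : denom (heckeDiag p) z = 1 := by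
  simp [denom, coe_heckeDiag]

theorem coe_heckeUpper_smul (b : ℤ) (z : ℍ) : ((heckeUpper p b • z : ℍ) : ℂ) = (z + b) / p := by
  rw [coe_smul_of_det_pos (by rw [det_heckeUpper]; exact natCast_real_pos p), denom_heckeUpper]
  simp [num, coe_heckeUpper]

theorem coe_heckeDiag_smul (z : ℍ) : ((heckeDiag p • z : ℍ) : ℂ) = p * z := by
  rw [coe_smul_of_det_pos (by rw [det_heckeDiag]; exact natCast_real_pos p), denom_heckeDiag]
  simp [num, coe_heckeDiag]

theorem slash_heckeUpper_apply (k : ℤ) (f : ℍ → ℂ) (b : ℤ) (z : ℍ) :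
    (f ∣[k] heckeUpper p b) z = (p : ℂ)⁻¹ * f (heckeUpper p b • z) := by
  have hp : (p : ℂ) ≠ 0 := NeZero.ne _
  rw [slash_apply, denom_heckeUpper, det_heckeUpper, σ, if_pos (by
    rw [det_heckeUpper]; exact natCast_real_pos p), abs_of_pos (natCast_real_pos p), zpow_sub₀
    (by simpa using hp), _root_.zpow_neg, zpow_one]
  push_cast
  have hk : (p : ℂ) ^ k ≠ 0 := zpow_ne_zero k hp
  field_simp
  rfl

theorem slash_heckeDiag_apply (k : ℤ) (f : ℍ → ℂ) (z : ℍ) :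
    (f ∣[k] heckeDiag p) z = (p : ℂ) ^ (k - 1) * f (heckeDiag p • z) := by
  rw [slash_apply, denom_heckeDiag, det_heckeDiag, σ, if_pos (by
    rw [det_heckeDiag]; exact natCast_real_pos p), abs_of_pos (natCast_real_pos p)]
  simp [mul_comm]

theorem qParam_heckeDiag_smul (z : ℍ) : qParam 1 (heckeDiag p • z : ℍ) = qParam 1 z ^ p := by
  rw [coe_heckeDiag_smul, qParam, qParam, ← Complex.exp_nat_mul]
  congr 1
  push_cast
  ring

theorem qParam_heckeUpper_smul (j : ℤ) (z : ℍ) :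
    qParam 1 (heckeUpper p j • z : ℍ) = qParam p z * ZMod.stdAddChar (j : ZMod p) := by
  rw [coe_heckeUpper_smul, ZMod.stdAddChar_coe, qParam, qParam,
    ← Complex.exp_add]
  congr 1
  push_cast
  ring

theorem qParam_natCast_pow (z : ℂ) : qParam p z ^ p = qParam 1 z := by
  have hp : (p : ℂ) ≠ 0 := NeZero.ne _
  rw [qParam, qParam, ← Complex.exp_nat_mul]
  congr 1
  push_cast
  field_simp

variable {f : ℍ → ℂ} {a : ℕ → ℂ} (hf : ∀ z : ℍ, HasSum (fun n ↦ a n * qParam 1 z ^ n) (f z))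
include hf

theorem hasSum_slash_heckeDiag (k : ℤ) (z : ℍ) :
    HasSum (fun n ↦ (p : ℂ) ^ (k - 1) * (if p ∣ n then a (n / p) else 0) * qParam 1 z ^ n)
      ((f ∣[k] heckeDiag p) z) := by
  rw [slash_heckeDiag_apply]
  simp_rw [mul_assoc]
  refine HasSum.mul_left _ ?_
  rw [← (mul_right_injective₀ (NeZero.ne p)).hasSum_iff]
  · refine (hf (heckeDiag p • z)).congr_fun fun n ↦ ?_
    simp [qParam_heckeDiag_smul, NeZero.pos p, pow_mul]
  · intro n hn
    rw [if_neg (fun ⟨m, hm⟩ ↦ hn ⟨m, hm.symm⟩), zero_mul]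

/-- Orthogonality of additive characters: summing over `j` kills the exponents prime to `p`, and the
resulting factor `p` cancels the `p⁻¹` of the slash action. -/
theorem hasSum_sum_slash_heckeUpper (k : ℤ) (z : ℍ) :
    HasSum (fun n ↦ a (p * n) * qParam 1 z ^ n)
      (∑ j : ZMod p, (f ∣[k] heckeUpper p j.val) z) := by
  have hp : (p : ℂ) ≠ 0 := NeZero.ne _
  simp_rw [slash_heckeUpper_apply, ← Finset.mul_sum]
  have h := (hasSum_sum fun (j : ZMod p) (_ : j ∈ Finset.univ) ↦
    hf (heckeUpper p j.val • z)).mul_left (p : ℂ)⁻¹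
  have hterm (n : ℕ) : (p : ℂ)⁻¹ * ∑ j : ZMod p, a n * qParam 1 (heckeUpper p j.val • z : ℍ) ^ n =
      if p ∣ n then a n * qParam p z ^ n else 0 := by
    have hchar (j : ZMod p) : a n * qParam 1 (heckeUpper p j.val • z : ℍ) ^ n =
        a n * qParam p z ^ n * ZMod.stdAddChar (j * (n : ZMod p)) := by
      rw [qParam_heckeUpper_smul, mul_pow, ← AddChar.map_nsmul_eq_pow]
      simp [mul_comm j, mul_assoc]
    simp_rw [hchar]
    rw [← Finset.mul_sum, AddChar.sum_mulShift _ (ZMod.isPrimitive_stdAddChar p)]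
    simp only [ZMod.natCast_eq_zero_iff, ZMod.card]
    split_ifs
    · field_simp
    · simp
  simp_rw [hterm] at h
  rw [← (mul_right_injective₀ (NeZero.ne p)).hasSum_iff] at h
  · refine h.congr_fun fun n ↦ ?_
    simp [pow_mul, qParam_natCast_pow]
  · intro n hn
    rw [if_neg (fun ⟨m, hm⟩ ↦ hn ⟨m, hm.symm⟩)]

/-- The effect of `T_p` on `q`-expansions. -/
theorem hasSum_heckeFun (k : ℤ) (z : ℍ) :
    HasSum (fun n ↦ (a (p * n) + (p : ℂ) ^ (k - 1) * (if p ∣ n then a (n / p) else 0)) *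
      qParam 1 z ^ n) (heckeFun p k f z) := by
  have h := (hasSum_sum_slash_heckeUpper (p := p) hf k z).add
    (hasSum_slash_heckeDiag (p := p) hf k z)
  simp_rw [← add_mul] at h
  simpa [heckeFun, add_comm] using h

end QExpansion

theorem CuspForm.coeff_qExpansion_hecke (p : ℕ) [Fact p.Prime] {k : ℤ} (f : CuspForm 𝒮ℒ k)
    (n : ℕ) :
    (qExpansion 1 (f.hecke p)).coeff n = (qExpansion 1 f).coeff (p * n) +
      (p : ℂ) ^ (k - 1) * (if p ∣ n then (qExpansion 1 f).coeff (n / p) else 0) := by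
  refine (ModularFormClass.qExpansion_coeff_unique one_pos one_mem_strictPeriods_SL
    (f := f.hecke p) (c := fun n ↦ (qExpansion 1 f).coeff (p * n) +
      (p : ℂ) ^ (k - 1) * (if p ∣ n then (qExpansion 1 f).coeff (n / p) else 0)) (fun z ↦ ?_) n).symm
  exact hasSum_heckeFun (fun z ↦ ModularForm.hasSum_qExpansion f one_pos one_mem_strictPeriods_SL z)
    k z

theorem ramanujanTau_one : ramanujanTau 1 = 1 := by
  exact_mod_cast (coeff_qExpansion_discriminant 1).symm.trans discriminant_qExpansion_coeff_one

/-- `Δ` is an eigenform of the Hecke operator `T_p`. -/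
theorem ramanujanTau_hecke {p : ℕ} (hp : p.Prime) (n : ℕ) :
    ramanujanTau (p * n) + (p : ℤ) ^ 11 * (if p ∣ n then ramanujanTau (n / p) else 0) =
      ramanujanTau p * ramanujanTau n := by
  have : Fact p.Prime := ⟨hp⟩
  obtain ⟨c, hc⟩ := CuspForm.exists_smul_discriminant_of_weight_eq_twelve
    (CuspForm.discriminant.hecke p)
  have key (n : ℕ) : (ramanujanTau (p * n) : ℂ) +
      (p : ℂ) ^ 11 * (if p ∣ n then (ramanujanTau (n / p) : ℂ) else 0) = c * ramanujanTau n := by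
    have h := CuspForm.coeff_qExpansion_hecke p CuspForm.discriminant n
    rw [← hc, FunLike.coe_smul,
      ModularForm.qExpansion_smul one_pos one_mem_strictPeriods_SL, PowerSeries.coeff_smul] at h
    simp only [CuspForm.coe_discriminant, coeff_qExpansion_discriminant] at h
    rw [← smul_eq_mul c, h]
    norm_num
  -- The coefficient at `n = 1` determines `c`, as `p ∤ 1`.
  have hc' : c = ramanujanTau p := by
    simpa [hp.one_lt.ne', hp.ne_one, ramanujanTau_one] using (key 1).symm
  have h := key n
  rw [hc'] at h
  split_ifs at h ⊢ <;> exact_mod_cast h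

theorem ramanujanTau_prime_pow_add_two {p : ℕ} (hp : p.Prime) (n : ℕ) :
    ramanujanTau (p ^ (n + 2)) =
      ramanujanTau p * ramanujanTau (p ^ (n + 1)) - (p : ℤ) ^ 11 * ramanujanTau (p ^ n) := by
  have h := ramanujanTau_hecke hp (p ^ (n + 1))
  rw [if_pos (dvd_pow_self p n.succ_ne_zero), ← pow_succ',
    pow_succ p n, Nat.mul_div_cancel _ hp.pos, ← pow_succ] at h
  linarith

/-- For fixed `n`, both sides satisfy the same second-order recurrence in `m`, so the cases `m = 0,
1` suffice. The shifted exponents avoid truncated subtraction. -/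
theorem ramanujanTau_prime_pow_add {p : ℕ} (hp : p.Prime) (m n : ℕ) :
    ramanujanTau (p ^ (m + n + 2)) =
      ramanujanTau (p ^ (m + 1)) * ramanujanTau (p ^ (n + 1)) -
        (p : ℤ) ^ 11 * ramanujanTau (p ^ m) * ramanujanTau (p ^ n) := by
  induction m using Nat.twoStepInduction with
  | zero =>
    simp only [zero_add, pow_zero, pow_one, ramanujanTau_one]
    rw [ramanujanTau_prime_pow_add_two hp]
    ring
  | one =>
    rw [show 1 + n + 2 = (n + 1) + 2 by ring, ramanujanTau_prime_pow_add_two hp,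
      ramanujanTau_prime_pow_add_two hp n, ramanujanTau_prime_pow_add_two hp 0]
    simp only [zero_add, pow_zero, pow_one, ramanujanTau_one]
    ring
  | more m h1 h2 =>
    rw [show m + 2 + n + 2 = (m + n + 2) + 2 by ring, ramanujanTau_prime_pow_add_two hp,
      show m + n + 2 + 1 = m + 1 + n + 2 by ring, h1, h2, show m + 2 + 1 = m + 1 + 2 by ring,
      ramanujanTau_prime_pow_add_two hp (m + 1)]
    rw [show m + 1 + 1 = m + 2 by ring, ramanujanTau_prime_pow_add_two hp m]
    ring

end Hecke

theorem corollary2 (p : ℕ) (hp : p.Prime) (m n : ℕ) (hm : 1 ≤ m) (hn : 1 ≤ n) :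
    ramanujanTau (p ^ (m + n)) =
      ramanujanTau (p ^ m) * ramanujanTau (p ^ n) -
        (p : ℤ) ^ 11 * ramanujanTau (p ^ (m - 1)) * ramanujanTau (p ^ (n - 1)) := by
  obtain ⟨m, rfl⟩ := Nat.exists_eq_add_of_le' hm
  obtain ⟨n, rfl⟩ := Nat.exists_eq_add_of_le' hn
  rw [show m + 1 + (n + 1) = m + n + 2 by ring, ramanujanTau_prime_pow_add hp]
  simp
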